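/- Let $\Gamma$ be a distance-regular graph with (finite) vertex set $X$, path-length distance function $\partial$ and diameter $D\ge 1$: that is, $\Gamma$ is a finite connected simple graph such that, with $\Gamma_i(x)=\{y\in X:\partial(x,y)=i\}$, the number $|\Gamma_i(x)\cap\Gamma_j(y)|$ depends only on $i,j$ and $\partial(x,y)$. Write $\Gamma(x)=\Gamma_1(x)$. For $0\le i\le D$ let $A_{(i)}$ be the $i$-th distance matrix, with $(x,y)$-entry $1$ if $\partial(x,y)=i$ and $0$ otherwise. Assume that $\Gamma$ is $Q$-polynomial with respect to an ordering $E_0,\dots,E_D$ of the primitive idempotents of its Bose–Mesner algebra $\mathrm{Span}_{\mathbb C}\{A_{(0)},\dots,A_{(D)}\}$, where $E_0=|X|^{-1}J$ and $J$ is the all-ones matrix. This means that the Krein parameters $q^h_{ij}$, defined by $E_i\circ E_j=|X|^{-1}\sum_{h=0}^D q^h_{ij}E_h$ with $\circ$ the entrywise product, satisfy for $0\le h,i,j\le D$: $q^h_{ij}=0$ if one of $h,i,j$ is greater than the sum of the other two, and $q^h_{ij}\ne0$ if one of $h,i,j$ is equal to the sum of the other two. Let $\theta_0,\dots,\theta_D\in\mathbb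 R$ be the corresponding eigenvalue sequence ($A_{(1)}E_i=\theta_iE_i$) and $\theta^*_0,\dots,\theta^*_D\in\mathbb R$ the dual eigenvalue sequence ($E_1=|X|^{-1}\sum_{i=0}^D\theta^*_iA_{(i)}$). Consider the following conditions on scalars $\beta,\gamma,\gamma^*,\varrho,\varrho^*\in\mathbb R$. (i) For $2\le i\le D-1$, $$\beta+1=\frac{\theta_{i-2}-\theta_{i+1}}{\theta_{i-1}-\theta_i}=\frac{\theta^*_{i-2}-\theta^*_{i+1}}{\theta^*_{i-1}-\theta^*_i}.$$ (ii) For $1\le i\le D-1$, $\gamma=\theta_{i-1}-\beta\theta_i+\theta_{i+1}$ and $\gamma^*=\theta^*_{i-1}-\beta\theta^*_i+\theta^*_{i+1}$. (iii) For $1\le i\le D$, $$\varrho=\theta_{i-1}^2-\beta\theta_{i-1}\theta_i+\theta_i^2-\gamma(\theta_{i-1}+\theta_i),\qquad \varrho^*=\theta_{i-1}^{*2}-\beta\theta^*_{i-1}\theta^*_i+\theta_i^{*2}-\gamma^*(\theta^*_{i-1}+\theta^*_i).$$ For scalars $\beta,\gamma,\gamma^*,\varrho,\varrho^*$, the $S_3$-symmetric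 tridiagonal algebra $\mathbb T(\beta,\gamma,\gamma^*,\varrho,\varrho^*)$ is the associative unital $\mathbb C$-algebra with generators $A_r,A^*_r$ ($r\in\{1,2,3\}$) and the following relations, where $[B,C]=BC-CB$: for all $r,s$, $[A_r,A_s]=0$ and $[A^*_r,A^*_s]=0$; for all $r$, $[A_r,A^*_r]=0$; and for all distinct $r,s$, $$[A_r,\,A_r^2A_s^*-\beta A_rA_s^*A_r+A_s^*A_r^2-\gamma(A_rA_s^*+A_s^*A_r)-\varrho A_s^*]=0,$$ $$[A_s^*,\,A_s^{*2}A_r-\beta A_s^*A_rA_s^*+A_rA_s^{*2}-\gamma^*(A_s^*A_r+A_rA_s^*)-\varrho^* A_r]=0.$$ Let $V$ be the complex vector space with basis $X$. **Theorem.** Real scalars $\beta,\gamma,\gamma^*,\varrho,\varrho^*$ satisfying (i)–(iii) exist. For any such scalars, the vector space $V\otimes V\otimes V$ becomes a $\mathbb T(\beta,\gamma,\gamma^*,\varrho,\varrho^*)$-module on which the generators act as follows: for $x,y,z\in X$, $$A_1(x\otimes y\otimes z)=\sum_{\xi\in\Gamma(x)}\xi\otimes y\otimes z,\quad A_2(x\otimes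 y\otimes z)=\sum_{\xi\in\Gamma(y)}x\otimes\xi\otimes z,\quad A_3(x\otimes y\otimes z)=\sum_{\xi\in\Gamma(z)}x\otimes y\otimes\xi,$$ $$A^*_1(x\otimes y\otimes z)=\theta^*_{\partial(y,z)}\,x\otimes y\otimes z,\quad A^*_2(x\otimes y\otimes z)=\theta^*_{\partial(z,x)}\,x\otimes y\otimes z,\quad A^*_3(x\otimes y\otimes z)=\theta^*_{\partial(x,y)}\,x\otimes y\otimes z.$$ -/

import Mathlib

open scoped TensorProduct Matrix

namespace SymTD

/-- The six generators `A_r`, `A*_r` of the `S₃`-symmetric tridiagonal algebra. The indices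
`1, 2, 3` are represented by `0, 1, 2 : Fin 3`. -/
inductive Gen : Type
  | A (r : Fin 3)
  | As (r : Fin 3)

/-- The generator `A_r`, in the free algebra. -/
def freeA (F : Type*) [Field F] (r : Fin 3) : FreeAlgebra F Gen := FreeAlgebra.ι F (Gen.A r)

/-- The generator `A*_r`, in the free algebra. -/
def freeAs (F : Type*) [Field F] (r : Fin 3) : FreeAlgebra F Gen := FreeAlgebra.ι F (Gen.As r)

/-- The expression `[B, B²C - β BCB + CB² - γ (BC + CB) - ϱ C]`, with `[x, y] = xy - yx`. -/
def tdExpr {F R : Type*} [Field F] [Ring R] [Algebra F R] (β γ ϱ : F) (B C : R) : R :=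
  ⁅B, B ^ 2 * C - β • (B * C * B) + C * B ^ 2 - γ • (B * C + C * B) - ϱ • C⁆

/-- The defining relations of the `S₃`-symmetric tridiagonal algebra. -/
inductive Rel {F : Type*} [Field F] (β γ γs ϱ ϱs : F) :
    FreeAlgebra F Gen → FreeAlgebra F Gen → Prop
  | comm_A (i j : Fin 3) : Rel β γ γs ϱ ϱs ⁅freeA F i, freeA F j⁆ 0
  | comm_As (i j : Fin 3) : Rel β γ γs ϱ ϱs ⁅freeAs F i, freeAs F j⁆ 0
  | comm_A_As (i : Fin 3) : Rel β γ γs ϱ ϱs ⁅freeA F i, freeAs F i⁆ 0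
  | td (i j : Fin 3) (h : i ≠ j) :
      Rel β γ γs ϱ ϱs (tdExpr β γ ϱ (freeA F i) (freeAs F j)) 0
  | td_dual (i j : Fin 3) (h : i ≠ j) :
      Rel β γ γs ϱ ϱs (tdExpr β γs ϱs (freeAs F j) (freeA F i)) 0

end SymTD

/-- The `S₃`-symmetric tridiagonal algebra `𝕋(β, γ, γ*, ϱ, ϱ*)` over a field `F`. -/
abbrev SymTDAlgebra {F : Type*} [Field F] (β γ γs ϱ ϱs : F) : Type _ :=
  RingQuot (SymTD.Rel β γ γs ϱ ϱs)

namespace SymTDAlgebra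

/-- The generator `A_r` of `𝕋(β, γ, γ*, ϱ, ϱ*)`. -/
noncomputable def A {F : Type*} [Field F] (β γ γs ϱ ϱs : F) (r : Fin 3) :
    SymTDAlgebra β γ γs ϱ ϱs :=
  RingQuot.mkAlgHom F (SymTD.Rel β γ γs ϱ ϱs) (SymTD.freeA F r)

/-- The generator `A*_r` of `𝕋(β, γ, γ*, ϱ, ϱ*)`. -/
noncomputable def As {F : Type*} [Field F] (β γ γs ϱ ϱs : F) (r : Fin 3) :
    SymTDAlgebra β γ γs ϱ ϱs :=
  RingQuot.mkAlgHom F (SymTD.Rel β γ γs ϱ ϱs) (SymTD.freeAs F r)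

end SymTDAlgebra

namespace SimpleGraph

/-- `Γ_i(x)`: the set of vertices at path-length distance `i` from `x`. -/
noncomputable def distSphere {X : Type*} [Fintype X] (G : SimpleGraph X) (i : ℕ) (x : X) : Finset X :=
  Finset.univ.filter fun y => G.dist x y = i

/-- A finite connected graph is distance-regular if for all `h, i, j` the number
`p^h_{ij} = |Γ_i(x) ∩ Γ_j(y)|` is the same for all vertices `x, y` at distance `h`. -/
def IsDistanceRegular {X : Type*} [Fintype X] [DecidableEq X] (G : SimpleGraph X) : Prop :=
  G.Connected ∧ ∀ h i j : ℕ, ∃ p : ℕ, ∀ x y : X, G.dist x y = h →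
    (G.distSphere i x ∩ G.distSphere j y).card = p

/-- The `i`-th distance matrix `A_i`. -/
noncomputable def distMatrix {X : Type*} (G : SimpleGraph X) (i : ℕ) : Matrix X X ℂ :=
  Matrix.of fun x y => if G.dist x y = i then 1 else 0

/-- The Bose-Mesner algebra: the span of the distance matrices `A_0, …, A_D`, where `D` is the
diameter. -/
def boseMesner {X : Type*} (G : SimpleGraph X) : Submodule ℂ (Matrix X X ℂ) :=
  Submodule.span ℂ (G.distMatrix '' {i | i ≤ G.diam})

/-- `E_0, …, E_D` is an ordering of the primitive idempotents of the Bose-Mesner algebra, with the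
convention that `E_0 = |X|⁻¹ J`, where `J` is the all-ones matrix. Only the values `E i` with
`i ≤ D` matter. -/
structure IsPrimitiveIdempotentOrdering {X : Type*} [Fintype X] [DecidableEq X]
    (G : SimpleGraph X) (E : ℕ → Matrix X X ℂ) : Prop where
  ne_zero : ∀ i ≤ G.diam, E i ≠ 0
  idem : ∀ i ≤ G.diam, E i * E i = E i
  orthogonal : ∀ i ≤ G.diam, ∀ j ≤ G.diam, i ≠ j → E i * E j = 0
  sum_eq_one : ∑ i ∈ Finset.range (G.diam + 1), E i = 1
  span_eq : Submodule.span ℂ (E '' {i | i ≤ G.diam}) = G.boseMesner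
  zero_eq : E 0 = (Fintype.card X : ℂ)⁻¹ • Matrix.of fun _ _ => 1

/-- `q h i j` are the Krein parameters `q^h_{ij}` with respect to `E_0, …, E_D`, given by
`E_i ∘ E_j = |X|⁻¹ ∑_h q^h_{ij} E_h`, where `∘` is the entrywise product. They exist and are unique,
since `E_0, …, E_D` is a basis of the Bose-Mesner algebra, which is closed under `∘`. -/
def IsKreinParameters {X : Type*} [Fintype X] (G : SimpleGraph X)
    (E : ℕ → Matrix X X ℂ) (q : ℕ → ℕ → ℕ → ℂ) : Prop :=
  ∀ i ≤ G.diam, ∀ j ≤ G.diam,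
    E i ⊙ E j = (Fintype.card X : ℂ)⁻¹ • ∑ h ∈ Finset.range (G.diam + 1), q h i j • E h

/-- `E_0, …, E_D` is a `Q`-polynomial ordering of the primitive idempotents: for `h, i, j ≤ D`, the
Krein parameter `q^h_{ij}` is zero if one of `h, i, j` is greater than the sum of the other two, and
nonzero if one of `h, i, j` is equal to the sum of the other two. -/
def IsQPolynomial {X : Type*} [Fintype X] [DecidableEq X] (G : SimpleGraph X)
    (E : ℕ → Matrix X X ℂ) : Prop :=
  G.IsPrimitiveIdempotentOrdering E ∧ ∃ q : ℕ → ℕ → ℕ → ℂ, G.IsKreinParameters E q ∧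
    ∀ h ≤ G.diam, ∀ i ≤ G.diam, ∀ j ≤ G.diam,
      ((i + j < h ∨ h + j < i ∨ h + i < j) → q h i j = 0) ∧
      ((h = i + j ∨ i = h + j ∨ j = h + i) → q h i j ≠ 0)

/-- `θ_0, …, θ_D` is the eigenvalue sequence for `E_0, …, E_D`: the scalar `θ_i` is the eigenvalue
of the adjacency matrix associated with `E_i`. -/
def IsEigenvalueSequence {X : Type*} [Fintype X] (G : SimpleGraph X)
    [DecidableRel G.Adj] (E : ℕ → Matrix X X ℂ) (θ : ℕ → ℝ) : Prop :=
  ∀ i ≤ G.diam, G.adjMatrix ℂ * E i = (θ i : ℂ) • E i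

/-- `θ*_0, …, θ*_D` is the dual eigenvalue sequence for `E_0, …, E_D`:
`E_1 = |X|⁻¹ ∑_i θ*_i A_i`. -/
def IsDualEigenvalueSequence {X : Type*} [Fintype X] (G : SimpleGraph X)
    (E : ℕ → Matrix X X ℂ) (θs : ℕ → ℝ) : Prop :=
  E 1 = (Fintype.card X : ℂ)⁻¹ •
    ∑ i ∈ Finset.range (G.diam + 1), (θs i : ℂ) • G.distMatrix i

/-- The standard module: the complex vector space with basis `X`. -/
abbrev StdModule (X : Type*) : Type _ := X →₀ ℂ

/-- The vertex `x`, viewed as a basis vector of the standard module. -/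
noncomputable def vert {X : Type*} (x : X) : StdModule X := Finsupp.single x 1

/-- The basis vector `x ⊗ y ⊗ z` of `V ⊗ V ⊗ V`. -/
noncomputable def vert₃ {X : Type*} (x y z : X) : StdModule X ⊗[ℂ] StdModule X ⊗[ℂ] StdModule X :=
  vert x ⊗ₜ[ℂ] vert y ⊗ₜ[ℂ] vert z

end SimpleGraph

/-- The conditions by which the scalars `β, γ, γ*, ϱ, ϱ*` are given by the eigenvalue sequence
`θ_0, …, θ_D` and the dual eigenvalue sequence `θ*_0, …, θ*_D`. -/
structure IsTDScalars (D : ℕ) (θ θs : ℕ → ℝ) (β γ γs ϱ ϱs : ℝ) : Prop where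
  beta : ∀ i, 2 ≤ i → i + 1 ≤ D →
    β + 1 = (θ (i - 2) - θ (i + 1)) / (θ (i - 1) - θ i)
  beta_dual : ∀ i, 2 ≤ i → i + 1 ≤ D →
    β + 1 = (θs (i - 2) - θs (i + 1)) / (θs (i - 1) - θs i)
  gamma : ∀ i, 1 ≤ i → i + 1 ≤ D → γ = θ (i - 1) - β * θ i + θ (i + 1)
  gamma_dual : ∀ i, 1 ≤ i → i + 1 ≤ D → γs = θs (i - 1) - β * θs i + θs (i + 1)
  rho : ∀ i, 1 ≤ i → i ≤ D →
    ϱ = θ (i - 1) ^ 2 - β * θ (i - 1) * θ i + θ i ^ 2 - γ * (θ (i - 1) + θ i)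
  rho_dual : ∀ i, 1 ≤ i → i ≤ D →
    ϱs = θs (i - 1) ^ 2 - β * θs (i - 1) * θs i + θs i ^ 2 - γs * (θs (i - 1) + θs i)

/-! Fix two of the three vertices in `x ⊗ y ⊗ z` and let the coordinate `r` vary. For `s ≠ r`, the
operators `A_r` and `A*_s` then act on a copy of `X → ℂ` as the adjacency matrix `A` and as the
diagonal dual adjacency matrix `A*` based at one of the fixed vertices. So the cubic relations on
the triple tensor product reduce to two matrix identities, valid for every base vertex; the
remaining commutators vanish because the operators touch or read independent data.

Both identities are checked blockwise. Between eigenspaces of `B` with eigenvalues `s` and `t`, the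
expression multiplies the block of `C` by `(s - t) * (s² - βst + t² - γ(s + t) - ϱ)`
(`SymTD.mul_tdExpr_mul`). This is zero when `s = t` and, by the equation for `ϱ`, when `s` and `t`
are consecutive. All other blocks of `C` vanish: for `C = A` by the triangle inequality, for `C =
A*` by the triple product relation (`IsQPolynomial.mul_dualAdjMatrix_mul_eq_zero`), where the Krein
parameters enter.

The scalars exist because the same block structure makes `A²A*A - AA*A²` a commutator `[f(A), A*]`
with `f` a polynomial. Comparing entries at large distance forces `deg f ≤ 3`; the cubic coefficient
then yields one `β` for both sequences (`IsQPolynomial.exists_cubic`), and `γ`, `ϱ` arise as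
constants of the recurrence. -/

namespace SimpleGraph

/-! ### Distances and the Bose–Mesner algebra -/

section Distance

variable {X : Type*} {G : SimpleGraph X}

/-- On a geodesic from `x` to `y` there are vertices at every intermediate distance. -/
lemma Connected.exists_dist_eq_dist_eq (hG : G.Connected) {x y : X} {k : ℕ}
    (hk : k ≤ G.dist x y) : ∃ v, G.dist x v = k ∧ G.dist v y = G.dist x y - k := by
  obtain ⟨p, hp⟩ := hG.exists_walk_length_eq_dist x y
  refine ⟨p.getVert k, ?_⟩
  have h1 := dist_le (p.take k)
  have h2 := dist_le (p.drop k)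
  have h3 := hG.dist_triangle (u := x) (v := p.getVert k) (w := y)
  rw [Walk.take_length] at h1
  rw [Walk.drop_length] at h2
  omega

lemma Connected.dist_le_diam_of_finite [Finite X] (hG : G.Connected) (x y : X) : G.dist x y ≤ G.diam := by
  have := hG.nonempty
  exact dist_le_diam (connected_iff_ediam_ne_top.mp hG)

lemma Connected.exists_dist_eq [Finite X] (hG : G.Connected) {k : ℕ} (hk : k ≤ G.diam) :
    ∃ x y, G.dist x y = k := by
  have := hG.nonempty
  obtain ⟨x, y, h⟩ := G.exists_dist_eq_diam
  obtain ⟨v, hv, -⟩ := hG.exists_dist_eq_dist_eq (x := x) (y := y) (h ▸ hk)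
  exact ⟨x, v, hv⟩

lemma distMatrix_apply (i : ℕ) (x y : X) :
    G.distMatrix i x y = if G.dist x y = i then 1 else 0 := rfl

lemma Connected.distMatrix_zero [DecidableEq X] (hG : G.Connected) : G.distMatrix 0 = 1 := by
  ext x y
  simp [distMatrix_apply, Matrix.one_apply, hG.dist_eq_zero_iff]

lemma transpose_eq_of_mem_boseMesner {M : Matrix X X ℂ} (hM : M ∈ G.boseMesner) : Mᵀ = M := by
  induction hM using Submodule.span_induction with
  | mem M hM =>
    obtain ⟨i, -, rfl⟩ := hM
    ext x y
    simp [distMatrix_apply, dist_comm]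
  | zero => simp
  | add M N _ _ hM hN => rw [Matrix.transpose_add, hM, hN]
  | smul c M _ hM => rw [Matrix.transpose_smul, hM]

end Distance

/-! ### Matrix entries as walk counts -/

section Walks

variable {X : Type*} [Fintype X] [DecidableEq X] {G : SimpleGraph X} [DecidableRel G.Adj]

lemma dist_le_of_adjMatrix_pow_ne_zero {k : ℕ} {x y : X}
    (h : (G.adjMatrix ℂ ^ k) x y ≠ 0) : G.dist x y ≤ k := by
  rw [adjMatrix_pow_apply_eq_card_walk, Nat.cast_ne_zero] at h
  obtain ⟨p, hp⟩ := Fintype.card_pos_iff.mp (Nat.pos_of_ne_zero h)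
  exact hp ▸ dist_le p

lemma adjMatrix_pow_dist_ne_zero (hG : G.Connected) (x y : X) :
    (G.adjMatrix ℂ ^ G.dist x y) x y ≠ 0 := by
  rw [adjMatrix_pow_apply_eq_card_walk, Nat.cast_ne_zero]
  obtain ⟨p, hp⟩ := hG.exists_walk_length_eq_dist x y
  exact (Fintype.card_pos_iff.mpr ⟨⟨p, hp⟩⟩).ne'

/-- A polynomial in the adjacency matrix of degree at most `∂(x, y)` has `(x, y)`-entry given by
its top coefficient. -/
lemma aeval_adjMatrix_apply {f : Polynomial ℂ} {x y : X} (h : f.natDegree ≤ G.dist x y) :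
    (Polynomial.aeval (G.adjMatrix ℂ) f) x y
      = f.coeff (G.dist x y) * (G.adjMatrix ℂ ^ G.dist x y) x y := by
  rw [Polynomial.aeval_eq_sum_range' (Nat.lt_succ_of_le h), Matrix.sum_apply,
    Finset.sum_range_succ, Finset.sum_eq_zero, zero_add, Matrix.smul_apply, smul_eq_mul]
  intro k hk
  rw [Matrix.smul_apply, smul_eq_mul]
  refine mul_eq_zero_of_right _ (by_contra fun hne => ?_)
  have := dist_le_of_adjMatrix_pow_ne_zero hne
  exact absurd (Finset.mem_range.mp hk) (by omega)

lemma pow_mul_diagonal_mul_pow_apply (d : X → ℂ) (k l : ℕ) (x y : X) :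
    (G.adjMatrix ℂ ^ k * Matrix.diagonal d * G.adjMatrix ℂ ^ l) x y
      = ∑ v, (G.adjMatrix ℂ ^ k) x v * d v * (G.adjMatrix ℂ ^ l) v y := by
  rw [Matrix.mul_apply]
  simp only [Matrix.mul_diagonal]

/-- If `d` takes the constant value `c` on the vertices `v` of all walks from `x` to `y` at position
`k`, then `d` can be replaced by the scalar `c`. -/
lemma pow_mul_diagonal_mul_pow_apply_of_forall {d : X → ℂ} {c : ℂ} {k l : ℕ} {x y : X}
    (h : ∀ v, G.dist x v ≤ k → G.dist v y ≤ l → d v = c) :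
    (G.adjMatrix ℂ ^ k * Matrix.diagonal d * G.adjMatrix ℂ ^ l) x y
      = c * (G.adjMatrix ℂ ^ (k + l)) x y := by
  rw [pow_mul_diagonal_mul_pow_apply, pow_add, Matrix.mul_apply, Finset.mul_sum]
  refine Finset.sum_congr rfl fun v _ => ?_
  by_cases h1 : (G.adjMatrix ℂ ^ k) x v = 0
  · simp [h1]
  by_cases h2 : (G.adjMatrix ℂ ^ l) v y = 0
  · simp [h2]
  rw [h v (dist_le_of_adjMatrix_pow_ne_zero h1) (dist_le_of_adjMatrix_pow_ne_zero h2)]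
  ring

end Walks

/-! ### The adjacency matrix generates the Bose–Mesner algebra -/

section BoseMesner

variable {X : Type*} [Fintype X] [DecidableEq X] {G : SimpleGraph X} [DecidableRel G.Adj]

/-- The product of a distance matrix with the adjacency matrix is a combination of distance
matrices. -/
lemma IsDistanceRegular.distMatrix_mul_adjMatrix_apply (hG : G.IsDistanceRegular) (i : ℕ) :
    ∃ p : ℕ → ℕ, ∀ x y, (G.distMatrix i * G.adjMatrix ℂ) x y = p (G.dist x y) := by
  choose p hp using fun h => hG.2 h i 1
  refine ⟨p, fun x y => ?_⟩
  rw [← hp _ x y rfl, Matrix.mul_apply]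
  simp only [distMatrix_apply, adjMatrix_apply, ite_mul, one_mul, zero_mul, distSphere]
  simp_rw [← ite_and]
  rw [Finset.sum_boole, ← Finset.filter_and]
  congr 3
  ext v
  rw [dist_eq_one_iff_adj, adj_comm]

/-- Multiplying the `i`-th distance matrix by the adjacency matrix gives distance matrices of index
at most `i + 1`, the last with nonzero coefficient, so the recurrence can be solved for it. -/
lemma IsDistanceRegular.distMatrix_mem_adjoin (hG : G.IsDistanceRegular) (i : ℕ)
    (hi : i ≤ G.diam) : G.distMatrix i ∈ Algebra.adjoin ℂ {G.adjMatrix ℂ} := by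
  induction i using Nat.strong_induction_on with
  | _ i ih =>
  rcases i with _ | i
  · rw [hG.1.distMatrix_zero]
    exact one_mem _
  obtain ⟨p, hp⟩ := hG.distMatrix_mul_adjMatrix_apply i
  have key : G.distMatrix i * G.adjMatrix ℂ
      = ∑ h ∈ Finset.range (i + 1), (p h : ℂ) • G.distMatrix h
        + (p (i + 1) : ℂ) • G.distMatrix (i + 1) := by
    rw [← Finset.sum_range_succ]
    ext x y
    simp only [Matrix.sum_apply, Matrix.smul_apply, distMatrix_apply, smul_eq_mul, mul_ite,
      mul_one, mul_zero, Finset.sum_ite_eq, Finset.mem_range]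
    split_ifs with h
    · exact hp x y
    · rw [Matrix.mul_apply]
      refine Finset.sum_eq_zero fun v _ => ?_
      rw [distMatrix_apply, adjMatrix_apply]
      split_ifs with h1 h2
      · have := hG.1.dist_triangle (u := x) (v := v) (w := y)
        rw [dist_eq_one_iff_adj.mpr h2] at this
        omega
      all_goals simp
  have hne : (p (i + 1) : ℂ) ≠ 0 := by
    obtain ⟨x, y, hxy⟩ := hG.1.exists_dist_eq hi
    obtain ⟨v, hv, hv'⟩ := hG.1.exists_dist_eq_dist_eq (x := x) (y := y) (k := i) (by omega)
    have h1 : G.Adj v y := dist_eq_one_iff_adj.mp (by omega)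
    rw [← hxy, ← hp x y, Matrix.mul_apply]
    simp only [distMatrix_apply, adjMatrix_apply, ite_mul, one_mul, zero_mul]
    simp_rw [← ite_and]
    rw [Finset.sum_boole, Nat.cast_ne_zero]
    exact Finset.card_ne_zero_of_mem (a := v) (by simp [hv, h1])
  have h2 : G.distMatrix (i + 1) = (p (i + 1) : ℂ)⁻¹ • (G.distMatrix i * G.adjMatrix ℂ
      - ∑ h ∈ Finset.range (i + 1), (p h : ℂ) • G.distMatrix h) := by
    rw [key, add_sub_cancel_left, inv_smul_smul₀ hne]
  rw [h2]
  refine Subalgebra.smul_mem _ (sub_mem (mul_mem (ih i (by omega) (by omega))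
    (Algebra.subset_adjoin rfl)) (sum_mem fun h hh => Subalgebra.smul_mem _ (ih h ?_ ?_) _)) _
  all_goals have := Finset.mem_range.mp hh; omega

lemma IsDistanceRegular.mem_adjoin (hG : G.IsDistanceRegular) {M : Matrix X X ℂ}
    (hM : M ∈ G.boseMesner) : M ∈ Algebra.adjoin ℂ {G.adjMatrix ℂ} := by
  have : G.boseMesner ≤ Subalgebra.toSubmodule (Algebra.adjoin ℂ {G.adjMatrix ℂ}) := by
    refine Submodule.span_le.mpr ?_
    rintro _ ⟨i, hi, rfl⟩
    exact hG.distMatrix_mem_adjoin i hi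
  exact this hM

lemma IsDistanceRegular.commute_adjMatrix (hG : G.IsDistanceRegular) {M : Matrix X X ℂ}
    (hM : M ∈ G.boseMesner) : Commute (G.adjMatrix ℂ) M :=
  Algebra.commute_of_mem_adjoin_singleton_of_commute (hG.mem_adjoin hM) (Commute.refl _)

end BoseMesner

end SimpleGraph

namespace SimpleGraph

/-! ### Eigenvalues, dual eigenvalues and the triple product relation -/

section DualEigenvalues

variable {X : Type*} [Fintype X] {G : SimpleGraph X} {E : ℕ → Matrix X X ℂ} {θs : ℕ → ℝ}

lemma IsDualEigenvalueSequence.apply_eq (hG : G.Connected)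
    (hθs : G.IsDualEigenvalueSequence E θs) (x y : X) :
    (θs (G.dist x y) : ℂ) = Fintype.card X * E 1 x y := by
  have := hG.nonempty
  have hn : (Fintype.card X : ℂ) ≠ 0 := by simp
  rw [hθs, Matrix.smul_apply, smul_eq_mul, mul_inv_cancel_left₀ hn]
  simp only [Matrix.sum_apply, Matrix.smul_apply, distMatrix_apply, smul_eq_mul, mul_ite,
    mul_one, mul_zero, Finset.sum_ite_eq, Finset.mem_range]
  rw [if_pos (Nat.lt_succ_of_le (hG.dist_le_diam_of_finite x y))]

end DualEigenvalues

section Idempotents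

variable {X : Type*} [Fintype X] [DecidableEq X] {G : SimpleGraph X}
  {E : ℕ → Matrix X X ℂ} {θ θs : ℕ → ℝ}

lemma IsPrimitiveIdempotentOrdering.mem_boseMesner (hE : G.IsPrimitiveIdempotentOrdering E)
    {i : ℕ} (hi : i ≤ G.diam) : E i ∈ G.boseMesner :=
  hE.span_eq ▸ Submodule.subset_span ⟨i, hi, rfl⟩

lemma IsPrimitiveIdempotentOrdering.mul_eq_ite (hE : G.IsPrimitiveIdempotentOrdering E)
    {i j : ℕ} (hi : i ≤ G.diam) (hj : j ≤ G.diam) : E i * E j = if i = j then E i else 0 := by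
  split_ifs with h
  · rw [← h, hE.idem i hi]
  · exact hE.orthogonal i hi j hj h

/-- A matrix is determined by its blocks with respect to a resolution of the identity. -/
lemma IsPrimitiveIdempotentOrdering.eq_zero_of_blocks (hE : G.IsPrimitiveIdempotentOrdering E)
    {M : Matrix X X ℂ} (h : ∀ i ≤ G.diam, ∀ j ≤ G.diam, E i * M * E j = 0) : M = 0 := by
  rw [← one_mul M, ← mul_one (1 * M), ← hE.sum_eq_one, Finset.sum_mul, Finset.sum_mul_sum]
  refine Finset.sum_eq_zero fun i hi => Finset.sum_eq_zero fun j hj => h i ?_ j ?_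
  all_goals grind

/-- `E 1` generates the Bose–Mesner algebra under the entrywise product. If two dual eigenvalues
agreed, all matrices of the algebra would take equal entries at the two corresponding distances,
which a distance matrix refutes. -/
lemma IsQPolynomial.injOn_dualEigenvalue (hG : G.Connected) (hE : G.IsQPolynomial E)
    (hD : 1 ≤ G.diam) (hθs : G.IsDualEigenvalueSequence E θs) :
    Set.InjOn θs {i | i ≤ G.diam} := by
  intro i hi j hj hij
  rw [Set.mem_ofPred_eq] at hi hj
  have := hG.nonempty
  have hn : (Fintype.card X : ℂ)⁻¹ ≠ 0 := by simp
  obtain ⟨hE, q, hq, hq'⟩ := hE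
  obtain ⟨x, y, hxy⟩ := hG.exists_dist_eq hi
  obtain ⟨x', y', hxy'⟩ := hG.exists_dist_eq hj
  have hE1 : E 1 x y = E 1 x' y' := by
    rw [hθs]
    simp only [Matrix.sum_apply, Matrix.smul_apply, distMatrix_apply, smul_eq_mul, mul_ite,
      mul_one, mul_zero, Finset.sum_ite_eq, Finset.mem_range, hxy, hxy']
    rw [if_pos (by omega), if_pos (by omega), hij]
  have hall : ∀ k, k ≤ G.diam → E k x y = E k x' y' := by
    intro k
    induction k using Nat.strong_induction_on with
    | _ k ih =>
    intro hk
    rcases k with _ | k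
    · simp [hE.zero_eq]
    have hprod := hq 1 hD k (by omega)
    -- The Krein parameters vanish for `h > k + 1` and not for `h = k + 1`, so `E (k + 1)` is
    -- determined entrywise by `E 1` and its predecessors.
    have hsplit : ∀ u v, (Fintype.card X : ℂ)⁻¹ * (∑ h ∈ Finset.range (k + 1), q h 1 k * E h u v
        + q (k + 1) 1 k * E (k + 1) u v) = E 1 u v * E k u v := by
      intro u v
      have h1 := congrFun (congrFun hprod u) v
      rw [Matrix.hadamard_apply, Matrix.smul_apply, Matrix.sum_apply, smul_eq_mul] at h1
      rw [h1, ← Finset.sum_range_succ]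
      congr 1
      refine Finset.sum_subset (Finset.range_subset_range.mpr (by omega)) fun h hh hh' => ?_
      simp only [Finset.mem_range] at hh hh'
      rw [(hq' h (by omega) 1 hD k (by omega)).1 (by omega), zero_mul]
    have hx := hsplit x y
    rw [hE1, ih k (by omega) (by omega), ← hsplit x' y', Finset.sum_congr rfl fun h hh => by
      rw [ih h (Finset.mem_range.mp hh) (by have := Finset.mem_range.mp hh; omega)]] at hx
    exact mul_left_cancel₀ ((hq' (k + 1) hk 1 hD k (by omega)).2 (by omega))
      (add_left_cancel (mul_left_cancel₀ hn hx))
  have hBM : ∀ M ∈ G.boseMesner, M x y = M x' y' := by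
    intro M hM
    rw [← hE.span_eq] at hM
    induction hM using Submodule.span_induction with
    | mem M hM =>
      obtain ⟨k, hk, rfl⟩ := hM
      exact hall k hk
    | zero => rfl
    | add M N _ _ hM hN => rw [Matrix.add_apply, Matrix.add_apply, hM, hN]
    | smul c M _ hM => rw [Matrix.smul_apply, Matrix.smul_apply, hM]
  have := hBM (G.distMatrix i) (Submodule.subset_span ⟨i, hi, rfl⟩)
  rw [distMatrix_apply, distMatrix_apply, if_pos hxy, hxy'] at this
  by_contra hne
  rw [if_neg (Ne.symm hne)] at this
  exact one_ne_zero this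

/-- The dual adjacency matrix with respect to the base vertex `z`. -/
noncomputable def dualAdjMatrix (G : SimpleGraph X) (θs : ℕ → ℝ) (z : X) : Matrix X X ℂ :=
  Matrix.diagonal fun x => (θs (G.dist z x) : ℂ)

variable [DecidableRel G.Adj]

lemma IsDistanceRegular.mul_adjMatrix (hG : G.IsDistanceRegular)
    (hE : G.IsPrimitiveIdempotentOrdering E) (hθ : G.IsEigenvalueSequence E θ) {i : ℕ}
    (hi : i ≤ G.diam) : E i * G.adjMatrix ℂ = (θ i : ℂ) • E i := by
  rw [← hθ i hi, (hG.commute_adjMatrix (hE.mem_boseMesner hi)).eq]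

/-- Each `E i` is a polynomial in the adjacency matrix, so it would act by one scalar on `E i` and
`E j` if their eigenvalues agreed; but it acts as `1` and `0`. -/
lemma IsDistanceRegular.injOn_eigenvalue (hG : G.IsDistanceRegular)
    (hE : G.IsPrimitiveIdempotentOrdering E) (hθ : G.IsEigenvalueSequence E θ) :
    Set.InjOn θ {i | i ≤ G.diam} := by
  intro i hi j hj hij
  have key : ∀ M ∈ Algebra.adjoin ℂ {G.adjMatrix ℂ}, ∃ c : ℂ,
      M * E i = c • E i ∧ M * E j = c • E j := by
    intro M hM
    induction hM using Algebra.adjoin_induction with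
    | mem M hM =>
      rw [Set.mem_singleton_iff.mp hM]
      exact ⟨θ i, hθ i hi, hij ▸ hθ j hj⟩
    | algebraMap c => exact ⟨c, by simp [Algebra.algebraMap_eq_smul_one]⟩
    | add M N _ _ hM hN =>
      obtain ⟨c, h1, h2⟩ := hM
      obtain ⟨d, h3, h4⟩ := hN
      exact ⟨c + d, by rw [add_mul, h1, h3, add_smul], by rw [add_mul, h2, h4, add_smul]⟩
    | mul M N _ _ hM hN =>
      obtain ⟨c, h1, h2⟩ := hM
      obtain ⟨d, h3, h4⟩ := hN
      exact ⟨d * c, by rw [mul_assoc, h3, mul_smul_comm, h1, mul_smul],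
        by rw [mul_assoc, h4, mul_smul_comm, h2, mul_smul]⟩
  by_contra hne
  obtain ⟨c, h1, h2⟩ := key (E i) (hG.mem_adjoin (hE.mem_boseMesner hi))
  rw [hE.orthogonal i hi j hj hne, eq_comm, smul_eq_zero] at h2
  rw [hE.idem i hi, h2.resolve_right (hE.ne_zero j hj), zero_smul] at h1
  exact hE.ne_zero i hi h1

/-- The eigenvalues are real and distinct, so `(E i)ᴴ` is killed by every other idempotent, whence
`E i * (E i)ᴴ = (E i)ᴴ`; the left side is Hermitian. This turns the trace in the triple product
relation into a squared norm. -/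
lemma IsDistanceRegular.conjTranspose_idempotent (hG : G.IsDistanceRegular)
    (hE : G.IsPrimitiveIdempotentOrdering E) (hθ : G.IsEigenvalueSequence E θ) {i : ℕ}
    (hi : i ≤ G.diam) : (E i)ᴴ = E i := by
  have hA : (G.adjMatrix ℂ)ᴴ = G.adjMatrix ℂ := by
    ext x y
    simp only [Matrix.conjTranspose_apply, adjMatrix_apply, G.adj_comm y x]
    split_ifs <;> simp
  have h1 : G.adjMatrix ℂ * (E i)ᴴ = (θ i : ℂ) • (E i)ᴴ := by
    have := congrArg Matrix.conjTranspose (hG.mul_adjMatrix hE hθ hi)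
    rw [Matrix.conjTranspose_mul, hA, Matrix.conjTranspose_smul] at this
    simpa using this
  have h2 : ∀ j ≤ G.diam, j ≠ i → E j * (E i)ᴴ = 0 := by
    intro j hj hne
    have h3 : (θ j : ℂ) • (E j * (E i)ᴴ) = (θ i : ℂ) • (E j * (E i)ᴴ) := by
      rw [← smul_mul_assoc, ← hG.mul_adjMatrix hE hθ hj, mul_assoc, h1, mul_smul_comm]
    rw [← sub_eq_zero, ← sub_smul, smul_eq_zero, sub_eq_zero] at h3
    refine h3.resolve_left fun h => hne (hG.injOn_eigenvalue hE hθ hj hi ?_)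
    exact_mod_cast h
  have h3 : E i * (E i)ᴴ = (E i)ᴴ := by
    conv_rhs => rw [← one_mul (E i)ᴴ, ← hE.sum_eq_one, Finset.sum_mul]
    rw [Finset.sum_eq_single i (fun j hj => h2 j (by grind)) (by grind)]
  have h4 := congrArg Matrix.conjTranspose h3
  rw [Matrix.conjTranspose_mul, Matrix.conjTranspose_conjTranspose, h3] at h4
  exact h4

open scoped ComplexOrder in
/-- The triple product relation: `E_i A* E_j = 0` if `|i - j| > 1`. -/
lemma IsQPolynomial.mul_dualAdjMatrix_mul_eq_zero (hG : G.IsDistanceRegular)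
    (hE : G.IsQPolynomial E) (hD : 1 ≤ G.diam) (hθ : G.IsEigenvalueSequence E θ)
    (hθs : G.IsDualEigenvalueSequence E θs) {i j : ℕ} (hi : i ≤ G.diam) (hj : j ≤ G.diam)
    (hij : i + 1 < j ∨ j + 1 < i) (z : X) : E i * G.dualAdjMatrix θs z * E j = 0 := by
  obtain ⟨hE, q, hq, hq'⟩ := hE
  have hsymm : ∀ k ≤ G.diam, ∀ x y, E k x y = E k y x := fun k hk x y =>
    congrFun (congrFun (transpose_eq_of_mem_boseMesner (hE.mem_boseMesner hk)) y) x
  have hd : ∀ z, (G.dualAdjMatrix θs z)ᴴ = G.dualAdjMatrix θs z := by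
    intro z
    rw [dualAdjMatrix, Matrix.diagonal_conjTranspose]
    congr 1
    ext x
    simp
  have htr : ∀ z, (E i * G.dualAdjMatrix θs z * E j * (E i * G.dualAdjMatrix θs z * E j)ᴴ).trace
      = ∑ x, ∑ y, (E i x y * E j x y) * (θs (G.dist z x) * θs (G.dist z y)) := by
    intro z
    rw [Matrix.conjTranspose_mul, Matrix.conjTranspose_mul, hd,
      hG.conjTranspose_idempotent hE hθ hi, hG.conjTranspose_idempotent hE hθ hj]
    rw [show E i * G.dualAdjMatrix θs z * E j * (E j * (G.dualAdjMatrix θs z * E i))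
      = E i * G.dualAdjMatrix θs z * (E j * E j) * G.dualAdjMatrix θs z * E i by noncomm_ring]
    rw [hE.idem j hj, Matrix.trace_mul_comm, ← mul_assoc, ← mul_assoc, ← mul_assoc, hE.idem i hi,
      Matrix.trace]
    simp only [Matrix.diag_apply, dualAdjMatrix, Matrix.mul_diagonal]
    refine Finset.sum_congr rfl fun x _ => ?_
    rw [Matrix.mul_apply, Finset.sum_mul]
    refine Finset.sum_congr rfl fun y _ => ?_
    rw [Matrix.mul_diagonal, hsymm j hj y x]
    ring
  -- Up to scaling, this is the identity `E 1 * E 1 = E 1` read entrywise.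
  have hsum : ∀ x y, ∑ z, (θs (G.dist z x) * θs (G.dist z y) : ℂ)
      = (Fintype.card X : ℂ) ^ 2 * E 1 y x := by
    intro x y
    conv_rhs => rw [hsymm 1 hD, ← hE.idem 1 hD, Matrix.mul_apply, Finset.mul_sum]
    refine Finset.sum_congr rfl fun z _ => ?_
    rw [hθs.apply_eq hG.1, hθs.apply_eq hG.1, hsymm 1 hD z x]
    ring
  -- Summed over all base vertices, the squared norms give a multiple of the trace of `(E i ⊙ E j) *
  -- E 1`, which is zero since `q 1 i j = 0`. As each norm is nonnegative, each vanishes.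
  have hzero : ∑ z, (E i * G.dualAdjMatrix θs z * E j *
      (E i * G.dualAdjMatrix θs z * E j)ᴴ).trace = 0 := by
    simp_rw [htr]
    rw [Finset.sum_comm]
    have : ∑ x, ∑ y, ∑ z, (E i x y * E j x y) * (θs (G.dist z x) * θs (G.dist z y) : ℂ)
        = (Fintype.card X : ℂ) ^ 2 * ((E i ⊙ E j) * E 1).trace := by
      rw [Matrix.trace, Finset.mul_sum]
      refine Finset.sum_congr rfl fun x _ => ?_
      rw [Matrix.diag_apply, Matrix.mul_apply, Finset.mul_sum]
      refine Finset.sum_congr rfl fun y _ => ?_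
      rw [← Finset.mul_sum, hsum, Matrix.hadamard_apply]
      ring
    have h0 : (E i ⊙ E j) * E 1 = 0 := by
      rw [hq i hi j hj, smul_mul_assoc, Finset.sum_mul, Finset.sum_eq_zero, smul_zero]
      intro h hh
      rw [smul_mul_assoc, hE.mul_eq_ite (by grind) hD]
      split_ifs with h1
      · rw [h1, (hq' 1 hD i hi j hj).1 (by omega), zero_smul]
      · rw [smul_zero]
    rw [h0, Matrix.trace_zero, mul_zero] at this
    rw [← this]
    refine Finset.sum_congr rfl fun x _ => ?_
    rw [Finset.sum_comm]
  rw [Finset.sum_eq_zero_iff_of_nonneg fun z _ =>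
    (Matrix.posSemidef_self_mul_conjTranspose _).trace_nonneg] at hzero
  exact Matrix.trace_mul_conjTranspose_self_eq_zero_iff.mp (hzero z (Finset.mem_univ z))

end Idempotents

end SimpleGraph

/-! ### Polynomials in the adjacency matrix and the common recurrence -/

section EigenMatrix

variable {R : Type*} [Ring R] [Algebra ℂ R] {A E : R} {c : ℂ}

lemma pow_mul_eq_smul (h : A * E = c • E) (k : ℕ) : A ^ k * E = c ^ k • E := by
  induction k with
  | zero => simp
  | succ k ih => rw [pow_succ, mul_assoc, h, mul_smul_comm, ih, smul_smul, pow_succ, mul_comm]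

lemma mul_pow_eq_smul (h : E * A = c • E) (k : ℕ) : E * A ^ k = c ^ k • E := by
  induction k with
  | zero => simp
  | succ k ih => rw [pow_succ', ← mul_assoc, h, smul_mul_assoc, ih, smul_smul, pow_succ']

lemma aeval_mul_eq_smul (h : A * E = c • E) (f : Polynomial ℂ) :
    Polynomial.aeval A f * E = f.eval c • E := by
  rw [Polynomial.aeval_eq_sum_range, Finset.sum_mul, Polynomial.eval_eq_sum_range, Finset.sum_smul]
  refine Finset.sum_congr rfl fun k _ => ?_
  rw [smul_mul_assoc, pow_mul_eq_smul h, smul_smul]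

lemma mul_aeval_eq_smul (h : E * A = c • E) (f : Polynomial ℂ) :
    E * Polynomial.aeval A f = f.eval c • E := by
  rw [Polynomial.aeval_eq_sum_range, Finset.mul_sum, Polynomial.eval_eq_sum_range, Finset.sum_smul]
  refine Finset.sum_congr rfl fun k _ => ?_
  rw [mul_smul_comm, mul_pow_eq_smul h, smul_smul]

end EigenMatrix

/-- A polynomial of degree at most `n` with prescribed consecutive differences at `n + 1` nodes. -/
lemma exists_polynomial_eval_sub {n : ℕ} {t : ℕ → ℂ} (ht : Set.InjOn t {i | i ≤ n}) (r : ℕ → ℂ) :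
    ∃ f : Polynomial ℂ, f.natDegree ≤ n ∧ ∀ i < n, f.eval (t i) - f.eval (t (i + 1)) = r i := by
  have ht' : Set.InjOn t (Finset.range (n + 1) : Finset ℕ) := fun i hi j hj h => by
    simp only [Finset.coe_range, Set.mem_Iio] at hi hj
    exact ht (Nat.lt_succ_iff.mp hi) (Nat.lt_succ_iff.mp hj) h
  refine ⟨Lagrange.interpolate (Finset.range (n + 1)) t fun i => -∑ k ∈ Finset.range i, r k,
    ?_, fun i hi => ?_⟩
  · refine Polynomial.natDegree_le_of_degree_le
      ((Lagrange.degree_interpolate_le _ ht').trans_eq ?_)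
    simp
  · rw [Lagrange.eval_interpolate_at_node _ ht' (Finset.mem_range.mpr (by omega)),
      Lagrange.eval_interpolate_at_node _ ht' (Finset.mem_range.mpr (by omega)),
      Finset.sum_range_succ]
    ring

namespace SimpleGraph

variable {X : Type*} [Fintype X] [DecidableEq X] {G : SimpleGraph X} [DecidableRel G.Adj]
  {E : ℕ → Matrix X X ℂ} {θ θs : ℕ → ℝ}

/-- `A²A*A - AA*A²` is a commutator of `A*` with a polynomial in `A`. -/
lemma IsQPolynomial.pow_dualAdjMatrix_eq (hG : G.IsDistanceRegular)
    (hE : G.IsQPolynomial E) (hD : 1 ≤ G.diam) (hθ : G.IsEigenvalueSequence E θ)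
    (hθs : G.IsDualEigenvalueSequence E θs) {f : Polynomial ℂ}
    (hf : ∀ i < G.diam, f.eval (θ i : ℂ) - f.eval (θ (i + 1) : ℂ)
      = θ i * θ (i + 1) * (θ i - θ (i + 1))) (z : X) :
    G.adjMatrix ℂ ^ 2 * G.dualAdjMatrix θs z * G.adjMatrix ℂ ^ 1
        - G.adjMatrix ℂ ^ 1 * G.dualAdjMatrix θs z * G.adjMatrix ℂ ^ 2
      = Polynomial.aeval (G.adjMatrix ℂ) f * G.dualAdjMatrix θs z
        - G.dualAdjMatrix θs z * Polynomial.aeval (G.adjMatrix ℂ) f := by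
  rw [← sub_eq_zero]
  refine hE.1.eq_zero_of_blocks fun i hi j hj => ?_
  set A := G.adjMatrix ℂ
  set S := G.dualAdjMatrix θs z
  have hi' := hG.mul_adjMatrix hE.1 hθ hi
  have hj' := hθ j hj
  have h : E i * (A ^ 2 * S * A ^ 1 - A ^ 1 * S * A ^ 2
      - (Polynomial.aeval A f * S - S * Polynomial.aeval A f)) * E j
      = (E i * A ^ 2) * S * (A ^ 1 * E j) - (E i * A ^ 1) * S * (A ^ 2 * E j)
      - ((E i * Polynomial.aeval A f) * S * E j - E i * S * (Polynomial.aeval A f * E j)) := by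
    noncomm_ring
  rw [h, mul_pow_eq_smul hi', mul_pow_eq_smul hi', pow_mul_eq_smul hj', pow_mul_eq_smul hj',
    aeval_mul_eq_smul hj', mul_aeval_eq_smul hi']
  simp only [smul_mul_assoc, mul_smul_comm, smul_smul, ← sub_smul]
  by_cases hij : i + 1 < j ∨ j + 1 < i
  · rw [hE.mul_dualAdjMatrix_mul_eq_zero hG hD hθ hθs hi hj hij z, smul_zero]
  rw [smul_eq_zero]
  left
  -- Diagonal blocks cancel on each side; the two neighbouring cases are what the differences of `f`
  -- were prescribed for.
  obtain rfl | rfl | rfl : i = j ∨ j = i + 1 ∨ i = j + 1 := by omega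
  · ring
  · linear_combination -hf i (by omega)
  · linear_combination hf j (by omega)

/-- The `cᵢ` are coefficients of the interpolating polynomial `f`. Its prescribed differences,
divided by `θ i - θ (i + 1)`, give the first relation; entries of the commutator identity at
distance 3 give the second. -/
lemma IsQPolynomial.exists_cubic (hG : G.IsDistanceRegular)
    (hE : G.IsQPolynomial E) (hD : 3 ≤ G.diam) (hθ : G.IsEigenvalueSequence E θ)
    (hθs : G.IsDualEigenvalueSequence E θs) :
    ∃ c₁ c₂ c₃ : ℂ,
      (∀ i < G.diam, (θ i * θ (i + 1) : ℂ) = c₃ * (θ i ^ 2 + θ i * θ (i + 1) + θ (i + 1) ^ 2)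
        + c₂ * (θ i + θ (i + 1)) + c₁) ∧
      ∀ i, i + 3 ≤ G.diam → c₃ * (θs i - θs (i + 3)) = (θs (i + 1) - θs (i + 2) : ℂ) := by
  have hinj := hG.injOn_eigenvalue hE.1 hθ
  have hinjs := hE.injOn_dualEigenvalue hG.1 (by omega) hθs
  obtain ⟨f, hdeg, hf⟩ := exists_polynomial_eval_sub (n := G.diam) (t := fun i => (θ i : ℂ))
    (fun i hi j hj h => hinj hi hj (Complex.ofReal_injective h))
    fun i => θ i * θ (i + 1) * (θ i - θ (i + 1))
  have key := hE.pow_dualAdjMatrix_eq hG (by omega) hθ hθs hf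
  have hentry : ∀ z x y, f.natDegree ≤ G.dist x y →
      (G.adjMatrix ℂ ^ 2 * G.dualAdjMatrix θs z * G.adjMatrix ℂ ^ 1) x y
        - (G.adjMatrix ℂ ^ 1 * G.dualAdjMatrix θs z * G.adjMatrix ℂ ^ 2) x y
      = f.coeff (G.dist x y) * (G.adjMatrix ℂ ^ G.dist x y) x y
        * (θs (G.dist z y) - θs (G.dist z x)) := by
    intro z x y hxy
    rw [← Matrix.sub_apply, key, Matrix.sub_apply, dualAdjMatrix, Matrix.mul_diagonal,
      Matrix.diagonal_mul, aeval_adjMatrix_apply hxy]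
    ring
  -- Were the degree `n` larger, the entry at `x`, `z` with `∂(z, x) = n` and base vertex `z` would
  -- be zero on the left, out of reach of walks of length 3, but on the right a product of the
  -- leading coefficient, a positive walk count and `θs 0 - θs n`.
  have hdeg3 : f.natDegree ≤ 3 := by
    by_contra! hlt
    obtain ⟨z, x, hzx⟩ := hG.1.exists_dist_eq hdeg
    have hfar : ∀ k l, k + l = 3 →
        (G.adjMatrix ℂ ^ k * G.dualAdjMatrix θs z * G.adjMatrix ℂ ^ l) x z = 0 := by
      intro k l hkl
      rw [dualAdjMatrix, pow_mul_diagonal_mul_pow_apply_of_forall (c := 0), zero_mul]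
      intro v h1 h2
      have := hG.1.dist_triangle (u := x) (v := v) (w := z)
      rw [dist_comm, hzx] at this
      omega
    have h := hentry z x z (by rw [dist_comm, hzx])
    rw [hfar 2 1 rfl, hfar 1 2 rfl, sub_self, eq_comm, mul_eq_zero, mul_eq_zero, dist_self,
      hzx, dist_comm, hzx] at h
    rcases h with (h | h) | h
    · rw [Polynomial.coeff_natDegree, Polynomial.leadingCoeff_eq_zero] at h
      rw [h, Polynomial.natDegree_zero] at hlt
      omega
    · refine adjMatrix_pow_dist_ne_zero hG.1 x z ?_
      rwa [dist_comm, hzx]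
    · have := hinjs (Nat.zero_le G.diam) hdeg (by exact_mod_cast sub_eq_zero.mp h)
      omega
  refine ⟨f.coeff 1, f.coeff 2, f.coeff 3, fun i hi => ?_, fun i hi => ?_⟩
  · have h := hf i hi
    rw [Polynomial.eval_eq_sum_range' (Nat.lt_succ_of_le hdeg3),
      Polynomial.eval_eq_sum_range' (Nat.lt_succ_of_le hdeg3)] at h
    simp only [Finset.sum_range_succ, Finset.sum_range_zero] at h
    have hne : (θ i - θ (i + 1) : ℂ) ≠ 0 := by
      intro h0
      have := hinj hi.le (show i + 1 ≤ G.diam from hi) (by exact_mod_cast sub_eq_zero.mp h0)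
      omega
    refine mul_left_cancel₀ hne ?_
    linear_combination -h
  · obtain ⟨z, x, hzx⟩ := hG.1.exists_dist_eq hi
    -- With `y` on a geodesic from `z` to `x`, every walk of length 3 from `x` to `y` is itself
    -- geodesic and approaches `z` by one at each step, so `A*` is constant at each position.
    obtain ⟨y, hzy, hyx⟩ := hG.1.exists_dist_eq_dist_eq (x := z) (y := x) (k := i) (by omega)
    have hxy : G.dist x y = 3 := by rw [dist_comm]; omega
    have hmid : ∀ k l j, k + l = 3 → j = i + l →
        (G.adjMatrix ℂ ^ k * G.dualAdjMatrix θs z * G.adjMatrix ℂ ^ l) x y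
          = θs j * (G.adjMatrix ℂ ^ 3) x y := by
      intro k l j hkl hj
      rw [dualAdjMatrix, pow_mul_diagonal_mul_pow_apply_of_forall (c := θs j), hkl]
      intro v h1 h2
      have h3 := hG.1.dist_triangle (u := z) (v := v) (w := x)
      have h4 := hG.1.dist_triangle (u := z) (v := y) (w := v)
      rw [dist_comm (u := v)] at h3
      rw [dist_comm (u := y) (v := v)] at h4
      rw [show G.dist z v = j by omega]
    have h := hentry z x y (by omega)
    rw [hmid 2 1 (i + 1) rfl rfl, hmid 1 2 (i + 2) rfl rfl, hxy, hzx, hzy] at h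
    have hne := adjMatrix_pow_dist_ne_zero hG.1 x y
    rw [hxy] at hne
    refine mul_left_cancel₀ hne ?_
    linear_combination -h

/-- The eigenvalues and the dual eigenvalues satisfy the same three term recurrence. -/
lemma IsQPolynomial.exists_recurrence (hG : G.IsDistanceRegular)
    (hE : G.IsQPolynomial E) (hθ : G.IsEigenvalueSequence E θ)
    (hθs : G.IsDualEigenvalueSequence E θs) :
    ∃ β : ℝ, ∀ i, i + 3 ≤ G.diam →
      (β + 1) * (θ (i + 1) - θ (i + 2)) = θ i - θ (i + 3) ∧
      (β + 1) * (θs (i + 1) - θs (i + 2)) = θs i - θs (i + 3) := by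
  by_cases hD : 3 ≤ G.diam
  swap
  -- For diameter below 3 the recurrence is vacuous and any `β` serves.
  · exact ⟨0, fun i hi => absurd hi (by omega)⟩
  have hinj := hG.injOn_eigenvalue hE.1 hθ
  have hinjs := hE.injOn_dualEigenvalue hG.1 (by omega) hθs
  obtain ⟨c₁, c₂, c₃, hc, hc'⟩ := hE.exists_cubic hG hD hθ hθs
  have hne : (θs 1 - θs 2 : ℂ) ≠ 0 := by
    intro h0
    have := hinjs (show 1 ≤ G.diam by omega) (show 2 ≤ G.diam by omega)
      (by exact_mod_cast sub_eq_zero.mp h0)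
    omega
  refine ⟨(θs 0 - θs 3) / (θs 1 - θs 2) - 1, fun i hi => ?_⟩
  set b : ℝ := (θs 0 - θs 3) / (θs 1 - θs 2) - 1 with hb
  -- `b` is read off from the dual eigenvalues at `i = 0`; since `β + 1` inverts `c₃`, it governs
  -- both sequences.
  have hbc : ((b : ℂ) + 1) * c₃ = 1 := by
    have h0 := hc' 0 hD
    rw [hb]
    push_cast
    rw [sub_add_cancel, div_mul_eq_mul_div, div_eq_one_iff_eq hne]
    linear_combination h0
  -- Subtracting consecutive quadratic relations leaves the factor `θ j - θ (j + 2)`, which is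
  -- cancelled.
  have hrec : ∀ j, j + 2 ≤ G.diam →
      (θ (j + 1) : ℂ) = c₃ * (θ (j + 2) + θ (j + 1) + θ j) + c₂ := by
    intro j hj
    have hne' : (θ j - θ (j + 2) : ℂ) ≠ 0 := by
      intro h0
      have := hinj (show j ≤ G.diam by omega) (show j + 2 ≤ G.diam from hj)
        (by exact_mod_cast sub_eq_zero.mp h0)
      omega
    refine mul_left_cancel₀ hne' ?_
    linear_combination hc j (by omega) - hc (j + 1) (by omega)
  constructor
  · have h : ((b : ℂ) + 1) * (θ (i + 1) - θ (i + 2)) = θ i - θ (i + 3) := by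
      linear_combination (b + 1 : ℂ) * hrec i (by omega) - (b + 1 : ℂ) * hrec (i + 1) (by omega)
        + (θ i - θ (i + 3) : ℂ) * hbc
    exact_mod_cast h
  · have h : ((b : ℂ) + 1) * (θs (i + 1) - θs (i + 2)) = θs i - θs (i + 3) := by
      linear_combination (-(b + 1 : ℂ)) * hc' i hi + (θs i - θs (i + 3) : ℂ) * hbc
    exact_mod_cast h

end SimpleGraph

/-- A solution of the homogeneous recurrence satisfies the inhomogeneous and quadratic ones. -/
lemma exists_gamma_rho {D : ℕ} {t : ℕ → ℝ} {β : ℝ}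
    (h : ∀ i, i + 3 ≤ D → (β + 1) * (t (i + 1) - t (i + 2)) = t i - t (i + 3)) :
    ∃ γ ϱ : ℝ, (∀ i, i + 2 ≤ D → γ = t i - β * t (i + 1) + t (i + 2)) ∧
      ∀ i, i + 1 ≤ D →
        ϱ = t i ^ 2 - β * t i * t (i + 1) + t (i + 1) ^ 2 - γ * (t i + t (i + 1)) := by
  have hγ : ∀ i, i + 2 ≤ D → t 0 - β * t 1 + t 2 = t i - β * t (i + 1) + t (i + 2) := by
    intro i
    induction i with
    | zero => intro _; rfl
    | succ i ih =>
      intro hi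
      rw [ih (by omega)]
      linear_combination -h i (by omega)
  -- Initial values serve as the constants. If `D < 2`, then `γ` involves values beyond `D`,
  -- harmlessly: its condition is vacuous, and `ϱ` is defined from the same `γ`.
  refine ⟨t 0 - β * t 1 + t 2,
    t 0 ^ 2 - β * t 0 * t 1 + t 1 ^ 2 - (t 0 - β * t 1 + t 2) * (t 0 + t 1), hγ, fun i => ?_⟩
  induction i with
  | zero => intro _; rfl
  | succ i ih =>
    intro hi
    rw [ih (by omega)]
    linear_combination (t (i + 2) - t i) * hγ i (by omega)

lemma SimpleGraph.IsQPolynomial.exists_isTDScalars {X : Type*} [Fintype X] [DecidableEq X]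
    {G : SimpleGraph X} [DecidableRel G.Adj] {E : ℕ → Matrix X X ℂ} {θ θs : ℕ → ℝ}
    (hG : G.IsDistanceRegular) (hE : G.IsQPolynomial E) (hD : 1 ≤ G.diam)
    (hθ : G.IsEigenvalueSequence E θ) (hθs : G.IsDualEigenvalueSequence E θs) :
    ∃ β γ γs ϱ ϱs : ℝ, IsTDScalars G.diam θ θs β γ γs ϱ ϱs := by
  obtain ⟨β, hβ⟩ := hE.exists_recurrence hG hθ hθs
  obtain ⟨γ, ϱ, hγ, hϱ⟩ := exists_gamma_rho fun i hi => (hβ i hi).1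
  obtain ⟨γs, ϱs, hγs, hϱs⟩ := exists_gamma_rho fun i hi => (hβ i hi).2
  have hne : ∀ {t : ℕ → ℝ}, Set.InjOn t {i | i ≤ G.diam} → ∀ i, i + 3 ≤ G.diam →
      t (i + 1) - t (i + 2) ≠ 0 := by
    intro t ht i hi h0
    have := ht (show i + 1 ≤ G.diam by omega) (show i + 2 ≤ G.diam by omega) (sub_eq_zero.mp h0)
    omega
  refine ⟨β, γ, γs, ϱ, ϱs, ?_, ?_, ?_, ?_, ?_, ?_⟩
  · intro i h2 hi
    obtain ⟨i, rfl⟩ := Nat.exists_eq_add_of_le' h2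
    exact eq_div_of_mul_eq (hne (hG.injOn_eigenvalue hE.1 hθ) i (by omega)) (hβ i (by omega)).1
  · intro i h2 hi
    obtain ⟨i, rfl⟩ := Nat.exists_eq_add_of_le' h2
    exact eq_div_of_mul_eq (hne (hE.injOn_dualEigenvalue hG.1 hD hθs) i (by omega))
      (hβ i (by omega)).2
  all_goals
    intro i h1 hi
    obtain ⟨i, rfl⟩ := Nat.exists_eq_add_of_le' h1
  · exact hγ i hi
  · exact hγs i hi
  · exact hϱ i hi
  · exact hϱs i hi

/-! ### The tridiagonal relations for matrices -/

namespace SymTD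

variable {F : Type*} [Field F]

lemma map_tdExpr {R S : Type*} [Ring R] [Algebra F R] [Ring S] [Algebra F S] (f : R →ₐ[F] S)
    (β γ ϱ : F) (B C : R) : f (tdExpr β γ ϱ B C) = tdExpr β γ ϱ (f B) (f C) := by
  simp [tdExpr, Ring.lie_def]

/-- This carries the matrix identities on `X → ℂ` over to the slices of the triple tensor product.
-/
lemma tdExpr_apply_of_intertwines {U W : Type*} [AddCommGroup U] [Module F U] [AddCommGroup W]
    [Module F W] {P Q : Module.End F W} {P' Q' : Module.End F U} (j : U →ₗ[F] W)
    (hP : ∀ u, P (j u) = j (P' u)) (hQ : ∀ u, Q (j u) = j (Q' u)) (β γ ϱ : F) (u : U) :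
    tdExpr β γ ϱ P Q (j u) = j (tdExpr β γ ϱ P' Q' u) := by
  simp [tdExpr, Ring.lie_def, pow_two, hP, hQ]

/-- The block of `tdExpr` between eigenspaces of `B`. -/
lemma mul_tdExpr_mul {R : Type*} [Ring R] [Algebra F R] {B C e e' : R} {s t : F}
    (he : e * B = s • e) (he' : B * e' = t • e') (β γ ϱ : F) :
    e * tdExpr β γ ϱ B C * e'
      = ((s - t) * (s ^ 2 - β * s * t + t ^ 2 - γ * (s + t) - ϱ)) • (e * C * e') := by
  have h1 : e * B ^ 2 = s ^ 2 • e := by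
    rw [pow_two, ← mul_assoc, he, smul_mul_assoc, he, smul_smul, pow_two]
  have h2 : B ^ 2 * e' = t ^ 2 • e' := by
    rw [pow_two, mul_assoc, he', mul_smul_comm, he', smul_smul, pow_two]
  set M := B ^ 2 * C - β • (B * C * B) + C * B ^ 2 - γ • (B * C + C * B) - ϱ • C with hM
  have h3 : e * M * e' = (s ^ 2 - β * s * t + t ^ 2 - γ * (s + t) - ϱ) • (e * C * e') := by
    have : e * M * e' = (e * B ^ 2) * C * e' - β • ((e * B) * C * (B * e'))
        + e * C * (B ^ 2 * e') - γ • ((e * B) * C * e' + e * C * (B * e')) - ϱ • (e * C * e') := by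
      simp only [hM, mul_add, mul_sub, add_mul, sub_mul, smul_mul_assoc, mul_smul_comm, mul_assoc]
    rw [this, he, he', h1, h2]
    simp only [smul_mul_assoc, mul_smul_comm]
    module
  have h4 : e * tdExpr β γ ϱ B C * e' = (e * B) * M * e' - e * M * (B * e') := by
    rw [tdExpr, ← hM, Ring.lie_def]
    noncomm_ring
  rw [h4, he, he', smul_mul_assoc, smul_mul_assoc, mul_smul_comm, h3]
  module

end SymTD

lemma IsTDScalars.rho_succ {D : ℕ} {θ θs : ℕ → ℝ} {β γ γs ϱ ϱs : ℝ}
    (h : IsTDScalars D θ θs β γ γs ϱ ϱs) {i : ℕ} (hi : i + 1 ≤ D) :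
    (ϱ : ℂ) = θ i ^ 2 - β * θ i * θ (i + 1) + θ (i + 1) ^ 2 - γ * (θ i + θ (i + 1)) := by
  exact_mod_cast h.rho (i + 1) (by omega) hi

lemma IsTDScalars.rho_dual_succ {D : ℕ} {θ θs : ℕ → ℝ} {β γ γs ϱ ϱs : ℝ}
    (h : IsTDScalars D θ θs β γ γs ϱ ϱs) {i : ℕ} (hi : i + 1 ≤ D) :
    (ϱs : ℂ) = θs i ^ 2 - β * θs i * θs (i + 1) + θs (i + 1) ^ 2 - γs * (θs i + θs (i + 1)) := by
  exact_mod_cast h.rho_dual (i + 1) (by omega) hi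

namespace SimpleGraph

variable {X : Type*} [Fintype X] [DecidableEq X] {G : SimpleGraph X} [DecidableRel G.Adj]
  {E : ℕ → Matrix X X ℂ} {θ θs : ℕ → ℝ} {β γ γs ϱ ϱs : ℝ}

lemma IsQPolynomial.tdExpr_adjMatrix (hG : G.IsDistanceRegular) (hE : G.IsQPolynomial E)
    (hD : 1 ≤ G.diam) (hθ : G.IsEigenvalueSequence E θ) (hθs : G.IsDualEigenvalueSequence E θs)
    (h : IsTDScalars G.diam θ θs β γ γs ϱ ϱs) (z : X) :
    SymTD.tdExpr (β : ℂ) γ ϱ (G.adjMatrix ℂ) (G.dualAdjMatrix θs z) = 0 := by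
  refine hE.1.eq_zero_of_blocks fun i hi j hj => ?_
  rw [SymTD.mul_tdExpr_mul (hG.mul_adjMatrix hE.1 hθ hi) (hθ j hj)]
  by_cases hij : i + 1 < j ∨ j + 1 < i
  · rw [hE.mul_dualAdjMatrix_mul_eq_zero hG hD hθ hθs hi hj hij z, smul_zero]
  rw [smul_eq_zero]
  left
  obtain rfl | rfl | rfl : i = j ∨ j = i + 1 ∨ i = j + 1 := by omega
  · ring
  · rw [h.rho_succ hj]
    ring
  · rw [h.rho_succ hi]
    ring

lemma Connected.tdExpr_dualAdjMatrix (hG : G.Connected)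
    (h : IsTDScalars G.diam θ θs β γ γs ϱ ϱs) (z : X) :
    SymTD.tdExpr (β : ℂ) γs ϱs (G.dualAdjMatrix θs z) (G.adjMatrix ℂ) = 0 := by
  have hl : ∀ x, Matrix.single x x (1 : ℂ) * G.dualAdjMatrix θs z
      = (θs (G.dist z x) : ℂ) • Matrix.single x x 1 := by
    intro x
    ext u v
    rw [dualAdjMatrix, Matrix.mul_diagonal, Matrix.smul_apply, Matrix.single_apply]
    split_ifs with huv
    · simp [huv.2]
    · simp
  have hr : ∀ x, G.dualAdjMatrix θs z * Matrix.single x x (1 : ℂ)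
      = (θs (G.dist z x) : ℂ) • Matrix.single x x 1 := by
    intro x
    ext u v
    rw [dualAdjMatrix, Matrix.diagonal_mul, Matrix.smul_apply, Matrix.single_apply]
    split_ifs with huv
    · simp [huv.1]
    · simp
  -- The diagonal matrix units play the part of the idempotents: blocks of `A` vanish off edges, and
  -- along an edge the distance to `z` changes by at most one.
  rw [← one_mul (SymTD.tdExpr _ _ _ _ _),
    ← mul_one (1 * SymTD.tdExpr _ _ _ (G.dualAdjMatrix θs z) _), ← Matrix.sum_single_one, Finset.sum_mul,
    Finset.sum_mul_sum]
  refine Finset.sum_eq_zero fun x _ => Finset.sum_eq_zero fun y _ => ?_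
  rw [SymTD.mul_tdExpr_mul (hl x) (hr y)]
  by_cases hxy : G.Adj x y
  · rw [smul_eq_zero]
    left
    have h1 := hG.dist_triangle (u := z) (v := x) (w := y)
    have h2 := hG.dist_triangle (u := z) (v := y) (w := x)
    rw [dist_eq_one_iff_adj.mpr hxy] at h1
    rw [dist_eq_one_iff_adj.mpr hxy.symm] at h2
    have h3 := hG.dist_le_diam_of_finite z x
    have h4 := hG.dist_le_diam_of_finite z y
    obtain h5 | h5 | h5 : G.dist z x = G.dist z y ∨ G.dist z y = G.dist z x + 1 ∨
        G.dist z x = G.dist z y + 1 := by omega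
    · rw [h5]
      ring
    · rw [h5, h.rho_dual_succ (h5 ▸ h4)]
      ring
    · rw [h5, h.rho_dual_succ (h5 ▸ h3)]
      ring
  · have : Matrix.single x x 1 * G.adjMatrix ℂ * Matrix.single y y 1 = 0 := by
      rw [Matrix.single_mul_mul_single]
      simp [hxy]
    rw [this, smul_zero]

/-! ### Operators on the triple tensor product -/

section TripleTensor

variable {W : Type*} [AddCommGroup W] [Module ℂ W] (b : Module.Basis (Fin 3 → X) ℂ W)

/-- The adjacency operator acting on the coordinate `r`. -/
noncomputable def adjOp (G : SimpleGraph X) [DecidableRel G.Adj] (r : Fin 3) : Module.End ℂ W :=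
  b.constr ℂ fun f => ∑ ξ with G.Adj (f r) ξ, b (Function.update f r ξ)

/-- The operator acting on a basis vector by the dual eigenvalue for the distance between the two
coordinates other than `s`. -/
noncomputable def dualOp (G : SimpleGraph X) (θs : ℕ → ℝ) (s : Fin 3) : Module.End ℂ W :=
  b.constr ℂ fun f => (θs (G.dist (f (s + 1)) (f (s + 2))) : ℂ) • b f

omit [DecidableEq X] in
lemma adjOp_basis (r : Fin 3) (f : Fin 3 → X) :
    adjOp b G r (b f) = ∑ ξ with G.Adj (f r) ξ, b (Function.update f r ξ) :=
  b.constr_basis _ _ _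

omit [Fintype X] [DecidableEq X] [DecidableRel G.Adj] in
lemma dualOp_basis (s : Fin 3) (f : Fin 3 → X) :
    dualOp b G θs s (b f) = (θs (G.dist (f (s + 1)) (f (s + 2))) : ℂ) • b f :=
  b.constr_basis _ _ _

omit [DecidableEq X] in
lemma commute_adjOp (r s : Fin 3) : Commute (adjOp b G r) (adjOp b G s) := by
  rcases eq_or_ne r s with rfl | hrs
  · exact Commute.refl _
  refine b.ext fun f => ?_
  simp only [Module.End.mul_apply, adjOp_basis, map_sum, Function.update_of_ne hrs,
    Function.update_of_ne hrs.symm]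
  rw [Finset.sum_comm]
  simp_rw [Function.update_comm hrs]

omit [Fintype X] [DecidableEq X] [DecidableRel G.Adj] in
lemma commute_dualOp (r s : Fin 3) : Commute (dualOp b G θs r) (dualOp b G θs s) := by
  refine b.ext fun f => ?_
  simp only [Module.End.mul_apply, dualOp_basis, map_smul]
  rw [smul_comm]

-- The dual operator `r` reads only the coordinates that the adjacency operator `r` leaves fixed.
omit [DecidableEq X] in
lemma commute_adjOp_dualOp (r : Fin 3) : Commute (adjOp b G r) (dualOp b G θs r) := by
  have h1 : r + 1 ≠ r := by revert r; decide
  have h2 : r + 2 ≠ r := by revert r; decide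
  refine b.ext fun f => ?_
  simp only [Module.End.mul_apply, adjOp_basis, dualOp_basis, map_smul, map_sum,
    Function.update_of_ne h1, Function.update_of_ne h2, Finset.smul_sum]

/-- The embedding of the functions on `X` obtained by varying the coordinate `r` of `f`. -/
noncomputable def slotMap (f : Fin 3 → X) (r : Fin 3) : (X → ℂ) →ₗ[ℂ] W :=
  Fintype.linearCombination ℂ fun x => b (Function.update f r x)

lemma slotMap_single (f : Fin 3 → X) (r : Fin 3) : slotMap b f r (Pi.single (f r) 1) = b f := by
  rw [slotMap, Fintype.linearCombination_apply_single, Function.update_eq_self, one_smul]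

lemma adjOp_slotMap (f : Fin 3 → X) (r : Fin 3) (u : X → ℂ) :
    adjOp b G r (slotMap b f r u)
      = slotMap b f r (Matrix.toLinAlgEquiv' (G.adjMatrix ℂ) u) := by
  simp only [slotMap, Fintype.linearCombination_apply, map_sum, map_smul, adjOp_basis,
    Function.update_idem, Matrix.toLinAlgEquiv'_apply, adjMatrix_mulVec_apply, Finset.smul_sum, Finset.sum_smul]
  simp only [neighborFinset_eq_filter, Finset.sum_filter, Function.update_self]
  rw [Finset.sum_comm]
  simp only [G.adj_comm]

-- Of the two coordinates that the dual operator `s` compares, one is `r`; the other stays fixed on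
-- the slice and supplies the base vertex `z`.
omit [DecidableRel G.Adj] in
lemma exists_dualOp_slotMap (f : Fin 3 → X) {r s : Fin 3} (hrs : r ≠ s) :
    ∃ z, ∀ u : X → ℂ, dualOp b G θs s (slotMap b f r u)
      = slotMap b f r (Matrix.toLinAlgEquiv' (G.dualAdjMatrix θs z) u) := by
  have h : r = s + 1 ∧ s + 2 ≠ r ∨ r = s + 2 ∧ s + 1 ≠ r := by revert r s; decide
  rcases h with ⟨rfl, h⟩ | ⟨rfl, h⟩
  · refine ⟨f (s + 2), fun u => ?_⟩
    simp only [slotMap, Fintype.linearCombination_apply, map_sum, map_smul, dualOp_basis,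
      Function.update_self, Function.update_of_ne h, Matrix.toLinAlgEquiv'_apply, dualAdjMatrix,
      Matrix.mulVec_diagonal, smul_smul]
    simp only [G.dist_comm, mul_comm]
  · refine ⟨f (s + 1), fun u => ?_⟩
    simp only [slotMap, Fintype.linearCombination_apply, map_sum, map_smul, dualOp_basis,
      Function.update_self, Function.update_of_ne h, Matrix.toLinAlgEquiv'_apply, dualAdjMatrix,
      Matrix.mulVec_diagonal, smul_smul]
    simp only [mul_comm]

lemma tdExpr_adjOp {β γ ϱ : ℂ}
    (h : ∀ z, SymTD.tdExpr β γ ϱ (G.adjMatrix ℂ) (G.dualAdjMatrix θs z) = 0) {r s : Fin 3}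
    (hrs : r ≠ s) : SymTD.tdExpr β γ ϱ (adjOp b G r) (dualOp b G θs s) = 0 := by
  refine b.ext fun f => ?_
  obtain ⟨z, hz⟩ := exists_dualOp_slotMap (G := G) (θs := θs) b f hrs
  rw [← slotMap_single b f r,
    SymTD.tdExpr_apply_of_intertwines _ (adjOp_slotMap b f r) hz]
  have := SymTD.map_tdExpr (Matrix.toLinAlgEquiv' : Matrix X X ℂ ≃ₐ[ℂ] _).toAlgHom β γ ϱ
    (G.adjMatrix ℂ) (G.dualAdjMatrix θs z)
  rw [h, map_zero] at this
  erw [← this]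
  simp

lemma tdExpr_dualOp {β γ ϱ : ℂ}
    (h : ∀ z, SymTD.tdExpr β γ ϱ (G.dualAdjMatrix θs z) (G.adjMatrix ℂ) = 0) {r s : Fin 3}
    (hrs : r ≠ s) : SymTD.tdExpr β γ ϱ (dualOp b G θs s) (adjOp b G r) = 0 := by
  refine b.ext fun f => ?_
  obtain ⟨z, hz⟩ := exists_dualOp_slotMap (G := G) (θs := θs) b f hrs
  rw [← slotMap_single b f r,
    SymTD.tdExpr_apply_of_intertwines _ hz (adjOp_slotMap b f r)]
  have := SymTD.map_tdExpr (Matrix.toLinAlgEquiv' : Matrix X X ℂ ≃ₐ[ℂ] _).toAlgHom β γ ϱ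
    (G.dualAdjMatrix θs z) (G.adjMatrix ℂ)
  rw [h, map_zero] at this
  erw [← this]
  simp

end TripleTensor

/-- The basis of `V ⊗ V ⊗ V` formed by the vectors `x ⊗ y ⊗ z`. -/
noncomputable def tripleBasis (X : Type*) :
    Module.Basis (Fin 3 → X) ℂ (StdModule X ⊗[ℂ] StdModule X ⊗[ℂ] StdModule X) :=
  ((Finsupp.basisSingleOne.tensorProduct Finsupp.basisSingleOne).tensorProduct
    Finsupp.basisSingleOne).reindex
    { toFun := fun p => ![p.1.1, p.1.2, p.2]
      invFun := fun f => ((f 0, f 1), f 2)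
      left_inv := fun p => by simp
      right_inv := fun f => by ext i; fin_cases i <;> simp }

omit [Fintype X] [DecidableEq X] in
lemma tripleBasis_apply (f : Fin 3 → X) : tripleBasis X f = vert₃ (f 0) (f 1) (f 2) := by
  simp [tripleBasis, vert₃, vert]

end SimpleGraph

/-! ### From operators to the module structure -/

/-- An action of the generators satisfying the defining relations extends to the algebra. -/
lemma SymTDAlgebra.exists_algHom {F R : Type*} [Field F] [Ring R] [Algebra F R]
    {β γ γs ϱ ϱs : F} {a as : Fin 3 → R} (ha : ∀ r s, Commute (a r) (a s))
    (has : ∀ r s, Commute (as r) (as s)) (haas : ∀ r, Commute (a r) (as r))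
    (htd : ∀ r s, r ≠ s → SymTD.tdExpr β γ ϱ (a r) (as s) = 0)
    (htds : ∀ r s, r ≠ s → SymTD.tdExpr β γs ϱs (as s) (a r) = 0) :
    ∃ φ : SymTDAlgebra β γ γs ϱ ϱs →ₐ[F] R, (∀ r, φ (A β γ γs ϱ ϱs r) = a r) ∧
      ∀ r, φ (As β γ γs ϱ ϱs r) = as r := by
  let g : SymTD.Gen → R := fun x => SymTD.Gen.casesOn x a as
  have hA : ∀ r, FreeAlgebra.lift F g (SymTD.freeA F r) = a r :=
    fun r => FreeAlgebra.lift_ι_apply g _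
  have hAs : ∀ r, FreeAlgebra.lift F g (SymTD.freeAs F r) = as r :=
    fun r => FreeAlgebra.lift_ι_apply g _
  refine ⟨RingQuot.liftAlgHom F ⟨FreeAlgebra.lift F g, ?_⟩, fun r => ?_, fun r => ?_⟩
  · intro x y hxy
    induction hxy with
    | comm_A i j => simp [Ring.lie_def, hA, (ha i j).eq]
    | comm_As i j => simp [Ring.lie_def, hAs, (has i j).eq]
    | comm_A_As i => simp [Ring.lie_def, hA, hAs, (haas i).eq]
    | td i j h => rw [SymTD.map_tdExpr, hA, hAs, htd i j h, map_zero]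
    | td_dual i j h => rw [SymTD.map_tdExpr, hA, hAs, htds i j h, map_zero]
  · rw [A, RingQuot.liftAlgHom_mkAlgHom_apply, hA]
  · rw [As, RingQuot.liftAlgHom_mkAlgHom_apply, hAs]

/-- Operators on a space with basis `X³` make it a representation of the `S₃`-symmetric
tridiagonal algebra. -/
lemma SimpleGraph.IsQPolynomial.exists_algHom {X W : Type*} [Fintype X] [DecidableEq X]
    [AddCommGroup W] [Module ℂ W] (b : Module.Basis (Fin 3 → X) ℂ W)
    {G : SimpleGraph X} [DecidableRel G.Adj] {E : ℕ → Matrix X X ℂ} {θ θs : ℕ → ℝ}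
    {β γ γs ϱ ϱs : ℝ} (hG : G.IsDistanceRegular) (hE : G.IsQPolynomial E)
    (hD : 1 ≤ G.diam) (hθ : G.IsEigenvalueSequence E θ) (hθs : G.IsDualEigenvalueSequence E θs)
    (h : IsTDScalars G.diam θ θs β γ γs ϱ ϱs) :
    ∃ φ : SymTDAlgebra (β : ℂ) (γ : ℂ) (γs : ℂ) (ϱ : ℂ) (ϱs : ℂ) →ₐ[ℂ] Module.End ℂ W,
      (∀ r, φ (SymTDAlgebra.A (β : ℂ) (γ : ℂ) (γs : ℂ) (ϱ : ℂ) (ϱs : ℂ) r) = adjOp b G r) ∧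
      ∀ r, φ (SymTDAlgebra.As (β : ℂ) (γ : ℂ) (γs : ℂ) (ϱ : ℂ) (ϱs : ℂ) r) = dualOp b G θs r :=
  SymTDAlgebra.exists_algHom (commute_adjOp b) (commute_dualOp b) (commute_adjOp_dualOp b)
    (fun _ _ => tdExpr_adjOp b (hE.tdExpr_adjMatrix hG hD hθ hθs h))
    (fun _ _ => tdExpr_dualOp b (hG.1.tdExpr_dualAdjMatrix h))

theorem theorem5p4 {X : Type*} [Fintype X] [DecidableEq X]
    (G : SimpleGraph X) [DecidableRel G.Adj]
    (hG : G.IsDistanceRegular) (hD : 1 ≤ G.diam)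
    (E : ℕ → Matrix X X ℂ) (hE : G.IsQPolynomial E)
    (θ θs : ℕ → ℝ) (hθ : G.IsEigenvalueSequence E θ) (hθs : G.IsDualEigenvalueSequence E θs) :
    (∃ β γ γs ϱ ϱs : ℝ, IsTDScalars G.diam θ θs β γ γs ϱ ϱs) ∧
    ∀ β γ γs ϱ ϱs : ℝ, IsTDScalars G.diam θ θs β γ γs ϱ ϱs →
      ∃ _ : Module (SymTDAlgebra (β : ℂ) (γ : ℂ) (γs : ℂ) (ϱ : ℂ) (ϱs : ℂ))
          (SimpleGraph.StdModule X ⊗[ℂ] SimpleGraph.StdModule X ⊗[ℂ] SimpleGraph.StdModule X),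
        IsScalarTower ℂ (SymTDAlgebra (β : ℂ) (γ : ℂ) (γs : ℂ) (ϱ : ℂ) (ϱs : ℂ))
          (SimpleGraph.StdModule X ⊗[ℂ] SimpleGraph.StdModule X ⊗[ℂ] SimpleGraph.StdModule X) ∧
        ∀ x y z : X,
          SymTDAlgebra.A (β : ℂ) (γ : ℂ) (γs : ℂ) (ϱ : ℂ) (ϱs : ℂ) 0 • SimpleGraph.vert₃ x y z
            = ∑ ξ ∈ G.neighborFinset x, SimpleGraph.vert₃ ξ y z ∧
          SymTDAlgebra.A (β : ℂ) (γ : ℂ) (γs : ℂ) (ϱ : ℂ) (ϱs : ℂ) 1 • SimpleGraph.vert₃ x y z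
            = ∑ ξ ∈ G.neighborFinset y, SimpleGraph.vert₃ x ξ z ∧
          SymTDAlgebra.A (β : ℂ) (γ : ℂ) (γs : ℂ) (ϱ : ℂ) (ϱs : ℂ) 2 • SimpleGraph.vert₃ x y z
            = ∑ ξ ∈ G.neighborFinset z, SimpleGraph.vert₃ x y ξ ∧
          SymTDAlgebra.As (β : ℂ) (γ : ℂ) (γs : ℂ) (ϱ : ℂ) (ϱs : ℂ) 0 • SimpleGraph.vert₃ x y z
            = (θs (G.dist y z) : ℂ) • SimpleGraph.vert₃ x y z ∧
          SymTDAlgebra.As (β : ℂ) (γ : ℂ) (γs : ℂ) (ϱ : ℂ) (ϱs : ℂ) 1 • SimpleGraph.vert₃ x y z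
            = (θs (G.dist z x) : ℂ) • SimpleGraph.vert₃ x y z ∧
          SymTDAlgebra.As (β : ℂ) (γ : ℂ) (γs : ℂ) (ϱ : ℂ) (ϱs : ℂ) 2 • SimpleGraph.vert₃ x y z
            = (θs (G.dist x y) : ℂ) • SimpleGraph.vert₃ x y z := by
  refine ⟨hE.exists_isTDScalars hG hD hθ hθs, fun β γ γs ϱ ϱs h => ?_⟩
  -- Negation is added to the existing additive monoid, so that addition remains the one in the
  -- statement.
  let _ : AddCommGroup
      (SimpleGraph.StdModule X ⊗[ℂ] SimpleGraph.StdModule X ⊗[ℂ] SimpleGraph.StdModule X) :=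
    Module.addCommMonoidToAddCommGroup ℂ
  let b := SimpleGraph.tripleBasis X
  obtain ⟨φ, hφA, hφAs⟩ := hE.exists_algHom
    (W := SimpleGraph.StdModule X ⊗[ℂ] SimpleGraph.StdModule X ⊗[ℂ] SimpleGraph.StdModule X) b hG hD hθ hθs h
  let inst : Module (SymTDAlgebra (β : ℂ) (γ : ℂ) (γs : ℂ) (ϱ : ℂ) (ϱs : ℂ))
      (SimpleGraph.StdModule X ⊗[ℂ] SimpleGraph.StdModule X ⊗[ℂ] SimpleGraph.StdModule X) :=
    Module.compHom _ φ.toRingHom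
  have hsmul : ∀ (a : SymTDAlgebra (β : ℂ) (γ : ℂ) (γs : ℂ) (ϱ : ℂ) (ϱs : ℂ))
      (w : SimpleGraph.StdModule X ⊗[ℂ] SimpleGraph.StdModule X ⊗[ℂ] SimpleGraph.StdModule X),
      a • w = φ a w := fun _ _ => rfl
  have hb : ∀ x y z : X, SimpleGraph.vert₃ x y z = b ![x, y, z] := fun x y z => by
    simp [b, SimpleGraph.tripleBasis_apply]
  refine ⟨inst, ⟨fun c a w => ?_⟩, fun x y z => ⟨?_, ?_, ?_, ?_, ?_, ?_⟩⟩
  · rw [hsmul, hsmul, map_smul, LinearMap.smul_apply]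
  all_goals simp only [hsmul, hφA, hφAs, hb, SimpleGraph.adjOp_basis, SimpleGraph.dualOp_basis,
    SimpleGraph.neighborFinset_eq_filter]
  · refine Finset.sum_congr rfl fun ξ _ => congrArg b ?_
    ext i
    fin_cases i <;> simp
  · refine Finset.sum_congr rfl fun ξ _ => congrArg b ?_
    ext i
    fin_cases i <;> simp
  · refine Finset.sum_congr rfl fun ξ _ => congrArg b ?_
    ext i
    fin_cases i <;> simp
  · simp
  · simp
  · simp
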